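/- Let $A,E\in\mathbb C^{n\times n}$ with $E$ invertible, $B\in\mathbb C^{n\times m}$, $C\in\mathbb C^{p\times n}$, $D\in\mathbb C^{p\times m}$, let $\|\cdot\|$ denote the spectral norm, and let $\varepsilon>0$ satisfy $\varepsilon\|D\|<1$. Write $\operatorname{spec}(M,E)=\{\lambda\in\mathbb C:\det(\lambda E-M)=0\}$, and define the $\varepsilon$-spectral value set $$\sigma_\varepsilon=\bigcup\{\operatorname{spec}(A+B\Delta(I-D\Delta)^{-1}C,\,E):\Delta\in\mathbb C^{m\times p},\ \|\Delta\|\le\varepsilon\},$$ its radius $\rho_\varepsilon=\max\{|\lambda|:\lambda\in\sigma_\varepsilon\}$, and the transfer function $G(\lambda)=C(\lambda E-A)^{-1}B+D$ for $\lambda\notin\operatorname{spec}(A,E)$. Put $\gamma=\varepsilon^{-1}$, $R_\gamma=D^*D-\gamma^2I$, $S_\gamma=DD^*-\gamma^2I$ and, for $r>0$, $$\mathcal S_{\gamma r}=\begin{bmatrix}A-BR_\gamma^{-1}D^*C&-\gamma BR_\gamma^{-1}B^*\\0&rE^*\end{bmatrix},\qquad \mathcal T_{\gamma r}=\begin{bmatrix}rE&0\\-\gamma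 C^*S_\gamma^{-1}C&A^*-C^*DR_\gamma^{-1}B^*\end{bmatrix}.$$ The pencil $(\mathcal S_{\gamma r},\mathcal T_{\gamma r})$ is called singular if $\det(\mathcal S_{\gamma r}-z\mathcal T_{\gamma r})=0$ for all $z\in\mathbb C$, and regular otherwise. Let $\eta>0$ be such that every eigenvalue of $(A,E)$ has modulus less than $\eta$ and the circle of radius $\eta$ centered at the origin lies in the interior of $\sigma_\varepsilon$. For $\theta\in[0,2\pi)$ let $R(\theta)=\{s>\eta: se^{\mathbf i\theta}\in\partial\sigma_\varepsilon\}$. Then the maximum defining $\rho_\varepsilon$ is attained; for every $\theta\in[0,2\pi)$ the set $R(\theta)$ is finite and nonempty, so that $\hat r(\theta)=\min R(\theta)>\eta$ is defined; and there is a largest $\delta>0$ such that for all $t\in[0,1]$ the circle of radius $\eta+t\delta$ centered at the origin is a subset of $\sigma_\varepsilon$. Suppose moreover that the largest singular value of $G(\lambda)$ is simple for every $\lambda$ with $|\lambda|=\eta+\delta$. Then one of the following holds: 1. $(\mathcal S_{\gamma r},\mathcal T_{\gamma r})$ is singular for $r=\eta+\delta$, and $\hat r(\theta)=\eta+\delta=\rho_\varepsilon$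 for every $\theta\in[0,2\pi)$; or 2. $(\mathcal S_{\gamma r},\mathcal T_{\gamma r})$ is regular for $r=\eta+\delta$ and, for $\theta$ uniformly distributed on $[0,2\pi)$, $\hat r(\theta)>\eta+\delta$ with probability one. -/

import Mathlib

open scoped Matrix.Norms.L2Operator

noncomputable section

namespace SpectralValueSet

/-- The (finite) eigenvalues of the square matrix pencil `(A, E)`, i.e. the roots of
`det (z E - A)`. -/
def pencilSpectrum {n : ℕ} (A E : Matrix (Fin n) (Fin n) ℂ) : Set ℂ :=
  {z : ℂ | (z • E - A).det = 0}

/-- The perturbed matrix `M(Δ) = A + B Δ (I - D Δ)⁻¹ C`. -/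
def perturbed {n m p : ℕ} (A : Matrix (Fin n) (Fin n) ℂ) (B : Matrix (Fin n) (Fin m) ℂ)
    (C : Matrix (Fin p) (Fin n) ℂ) (D : Matrix (Fin p) (Fin m) ℂ)
    (Δ : Matrix (Fin m) (Fin p) ℂ) : Matrix (Fin n) (Fin n) ℂ :=
  A + B * Δ * (1 - D * Δ)⁻¹ * C

/-- The `ε`-spectral value set: the union of the spectra of `(M(Δ), E)` over all complex `Δ` of
spectral norm at most `ε` (the norm on matrices is the `ℓ²` operator norm throughout). -/
def svs {n m p : ℕ} (ε : ℝ) (A : Matrix (Fin n) (Fin n) ℂ) (B : Matrix (Fin n) (Fin m) ℂ)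
    (C : Matrix (Fin p) (Fin n) ℂ) (D : Matrix (Fin p) (Fin m) ℂ)
    (E : Matrix (Fin n) (Fin n) ℂ) : Set ℂ :=
  {z : ℂ | ∃ Δ : Matrix (Fin m) (Fin p) ℂ, ‖Δ‖ ≤ ε ∧ z ∈ pencilSpectrum (perturbed A B C D Δ) E}

/-- The `ε`-spectral value set radius, the maximal modulus of a point of the spectral value set. -/
def svsRadius {n m p : ℕ} (ε : ℝ) (A : Matrix (Fin n) (Fin n) ℂ) (B : Matrix (Fin n) (Fin m) ℂ)
    (C : Matrix (Fin p) (Fin n) ℂ) (D : Matrix (Fin p) (Fin m) ℂ)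
    (E : Matrix (Fin n) (Fin n) ℂ) : ℝ :=
  sSup ((fun z : ℂ => ‖z‖) '' svs ε A B C D E)

/-- The transfer function `G(z) = C (z E - A)⁻¹ B + D`, meaningful for `z` outside the spectrum
of `(A, E)`. -/
def transfer {n m p : ℕ} (A : Matrix (Fin n) (Fin n) ℂ) (B : Matrix (Fin n) (Fin m) ℂ)
    (C : Matrix (Fin p) (Fin n) ℂ) (D : Matrix (Fin p) (Fin m) ℂ)
    (E : Matrix (Fin n) (Fin n) ℂ) (z : ℂ) : Matrix (Fin p) (Fin m) ℂ :=
  C * (z • E - A)⁻¹ * B + D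

/-- The largest singular value `‖G‖` of `G` is simple: `‖G‖²` is an eigenvalue of `Gᴴ G` of
multiplicity one. (Used for nonzero `G` only.) -/
def LargestSingularValueSimple {m p : ℕ} (G : Matrix (Fin p) (Fin m) ℂ) : Prop :=
  Module.finrank ℂ
    (Module.End.eigenspace (Matrix.toLin' (G.conjTranspose * G)) ((‖G‖ ^ 2 : ℝ) : ℂ)) = 1

/-- `R = Dᴴ D - γ² I`. -/
def matR {m p : ℕ} (γ : ℝ) (D : Matrix (Fin p) (Fin m) ℂ) : Matrix (Fin m) (Fin m) ℂ :=
  D.conjTranspose * D - ((γ : ℂ) ^ 2) • (1 : Matrix (Fin m) (Fin m) ℂ)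

/-- `S = D Dᴴ - γ² I`. -/
def matS {m p : ℕ} (γ : ℝ) (D : Matrix (Fin p) (Fin m) ℂ) : Matrix (Fin p) (Fin p) ℂ :=
  D * D.conjTranspose - ((γ : ℂ) ^ 2) • (1 : Matrix (Fin p) (Fin p) ℂ)

/-- The first matrix `𝒮_{γ r}` of the symplectic pencil for the circle of radius `r`. -/
def pencilS {n m p : ℕ} (γ r : ℝ) (A : Matrix (Fin n) (Fin n) ℂ) (B : Matrix (Fin n) (Fin m) ℂ)
    (C : Matrix (Fin p) (Fin n) ℂ) (D : Matrix (Fin p) (Fin m) ℂ)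
    (E : Matrix (Fin n) (Fin n) ℂ) : Matrix (Fin n ⊕ Fin n) (Fin n ⊕ Fin n) ℂ :=
  Matrix.fromBlocks
    (A - B * (matR γ D)⁻¹ * D.conjTranspose * C)
    (-((γ : ℂ) • (B * (matR γ D)⁻¹ * B.conjTranspose)))
    0
    ((r : ℂ) • E.conjTranspose)

/-- The second matrix `𝒯_{γ r}` of the symplectic pencil for the circle of radius `r`. -/
def pencilT {n m p : ℕ} (γ r : ℝ) (A : Matrix (Fin n) (Fin n) ℂ) (B : Matrix (Fin n) (Fin m) ℂ)
    (C : Matrix (Fin p) (Fin n) ℂ) (D : Matrix (Fin p) (Fin m) ℂ)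
    (E : Matrix (Fin n) (Fin n) ℂ) : Matrix (Fin n ⊕ Fin n) (Fin n ⊕ Fin n) ℂ :=
  Matrix.fromBlocks
    ((r : ℂ) • E)
    0
    (-((γ : ℂ) • (C.conjTranspose * (matS γ D)⁻¹ * C)))
    (A.conjTranspose - C.conjTranspose * D * (matR γ D)⁻¹ * B.conjTranspose)

/-- A square pencil `(S, T)` is regular if `det (S - z T)` does not vanish identically. -/
def IsRegularPencil {ι : Type} [Fintype ι] [DecidableEq ι] (S T : Matrix ι ι ℂ) : Prop :=
  ∃ z : ℂ, (S - z • T).det ≠ 0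

/-- A square pencil `(S, T)` is singular if `det (S - z T)` vanishes identically. -/
def IsSingularPencil {ι : Type} [Fintype ι] [DecidableEq ι] (S T : Matrix ι ι ℂ) : Prop :=
  ∀ z : ℂ, (S - z • T).det = 0

/-- The positive amounts `d` by which the circle of radius `η` about the origin can grow so that
all circles of radius `η + t d`, `t ∈ [0, 1]`, are subsets of `K`. -/
def growths (K : Set ℂ) (η : ℝ) : Set ℝ :=
  {d : ℝ | 0 < d ∧ ∀ t ∈ Set.Icc (0 : ℝ) 1, Metric.sphere (0 : ℂ) (η + t * d) ⊆ K}

/-- The radii, larger than `η`, of the boundary points of `K` on the ray with angle `θ`. -/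
def boundaryRadii (K : Set ℂ) (η θ : ℝ) : Set ℝ :=
  {s : ℝ | η < s ∧ (s : ℂ) * Complex.exp (θ * Complex.I) ∈ frontier K}

/-- The smallest of the boundary radii beyond `η` on the ray with angle `θ`. -/
def rHat (K : Set ℂ) (η θ : ℝ) : ℝ :=
  sInf (boundaryRadii K η θ)

/-- The uniform probability distribution on `[0, 2π)`. -/
def uniformAngle : MeasureTheory.Measure ℝ :=
  ProbabilityTheory.cond MeasureTheory.volume (Set.Ico (0 : ℝ) (2 * Real.pi))

end SpectralValueSet

end

/-! Write `γ = ε⁻¹`. Off the eigenvalues of `(A, E)` the spectral value set is `{‖G‖ ≥ γ}`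
(`mem_svs_iff`), so at its boundary points `‖G‖ = γ`. For `‖z‖ = 1` with `r z` not an eigenvalue of
`(A, E)`, the symplectic pencil has determinant zero at `z` exactly when `γ` is a singular value of
`G (r z)` (`det_pencil_eq_zero_iff`). Hence boundary points yield zeros of a determinant that is
polynomial in `z` and in `r`.

For a fixed direction the polynomial in `r` has nonzero leading coefficient because `E` is
invertible, so each ray has finitely many boundary radii. Take `r = η + δ`. If the pencil is
regular, only finitely many directions carry a boundary point on the circle, and these form a null
set.

If the pencil is singular, `γ` is a singular value of `G` all along the circle, and at a touching
point with the boundary it is the largest one. Simplicity prevents another singular value from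
overtaking it, so by connectedness `‖G‖ = γ` on the whole circle (`norm_eq_of_isPreconnected`). The
maximum principle for `w ↦ G (1/w)`, whose value at `0` is `D` with `‖D‖ < γ`, then gives `‖G‖ < γ`
outside the circle (`norm_transfer_lt_of_forall_sphere`). No point of the spectral value set lies
beyond it, and all radii coincide. -/

namespace SpectralValueSet

/-! ### Singular values -/

open scoped MatrixOrder ComplexOrder in
/-- The square of the spectral norm of `G` is an eigenvalue of `Gᴴ G`. -/
theorem det_norm_sq_smul_sub_conjTranspose_mul_self {m p : ℕ} (G : Matrix (Fin p) (Fin m) ℂ)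
    (hG : G ≠ 0) :
    (((‖G‖ : ℂ) ^ 2) • (1 : Matrix (Fin m) (Fin m) ℂ) - G.conjTranspose * G).det = 0 := by
  have hm : Nonempty (Fin m) := by
    by_contra h
    rw [not_nonempty_iff] at h
    exact hG (Matrix.ext fun _ j => h.elim j)
  have h0 : (0 : Matrix (Fin m) (Fin m) ℂ) ≤ G.conjTranspose * G :=
    Matrix.nonneg_iff_posSemidef.2 (Matrix.posSemidef_conjTranspose_mul_self G)
  -- The norm of a nonnegative element of a nontrivial C⋆-algebra belongs to its spectrum, and `‖Gᴴ
  -- G‖ = ‖G‖ ^ 2`.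
  have h := CStarAlgebra.norm_mem_spectrum_of_nonneg h0
  have h' := spectrum.algebraMap_mem ℂ h
  rw [Matrix.l2_opNorm_conjTranspose_mul_self, spectrum.mem_iff, Matrix.isUnit_iff_isUnit_det,
    isUnit_iff_ne_zero, not_not, Algebra.algebraMap_eq_smul_one] at h'
  simpa [sq] using h'

/-- The square of the spectral norm of `G` is also an eigenvalue of `G Gᴴ`, stated in normalized
form. -/
theorem det_one_sub_smul_mul_conjTranspose_norm {m p : ℕ} (G : Matrix (Fin p) (Fin m) ℂ)
    (hG : G ≠ 0) :
    (1 - G * (((‖G‖ : ℂ) ^ 2)⁻¹ • G.conjTranspose)).det = 0 := by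
  have hn : ((‖G‖ : ℂ) ^ 2) ≠ 0 := by
    simpa using hG
  rw [Matrix.det_one_sub_mul_comm]
  have h := det_norm_sq_smul_sub_conjTranspose_mul_self G hG
  have e : (1 : Matrix (Fin m) (Fin m) ℂ) - (((‖G‖ : ℂ) ^ 2)⁻¹ • G.conjTranspose) * G =
      ((‖G‖ : ℂ) ^ 2)⁻¹ • (((‖G‖ : ℂ) ^ 2) • (1 : Matrix (Fin m) (Fin m) ℂ) -
        G.conjTranspose * G) := by
    rw [smul_sub, smul_smul, inv_mul_cancel₀ hn, one_smul, Matrix.smul_mul]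
  rw [e, Matrix.det_smul, h, mul_zero]

/-! ### Spectral value sets and the transfer function -/

section Membership

variable {n m p : ℕ} {A : Matrix (Fin n) (Fin n) ℂ} {B : Matrix (Fin n) (Fin m) ℂ}
  {C : Matrix (Fin p) (Fin n) ℂ} {D : Matrix (Fin p) (Fin m) ℂ} {E : Matrix (Fin n) (Fin n) ℂ}
  {ε : ℝ}

theorem norm_mul_lt_one {G : Matrix (Fin p) (Fin m) ℂ} {Δ : Matrix (Fin m) (Fin p) ℂ}
    (hG : ε * ‖G‖ < 1) (hΔ : ‖Δ‖ ≤ ε) : ‖G * Δ‖ < 1 := by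
  calc ‖G * Δ‖ ≤ ‖G‖ * ‖Δ‖ := Matrix.l2_opNorm_mul _ _
    _ ≤ ‖G‖ * ε := by gcongr
    _ < 1 := by rwa [mul_comm]

theorem det_one_sub_mul_ne_zero {G : Matrix (Fin p) (Fin m) ℂ} {Δ : Matrix (Fin m) (Fin p) ℂ}
    (hG : ε * ‖G‖ < 1) (hΔ : ‖Δ‖ ≤ ε) : (1 - G * Δ).det ≠ 0 :=
  isUnit_iff_ne_zero.1 ((Matrix.isUnit_iff_isUnit_det _).1
    (Units.oneSub _ (norm_mul_lt_one hG hΔ)).isUnit)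

/-- The characteristic determinant of the perturbed pencil in terms of the transfer function. -/
theorem det_smul_sub_perturbed {z : ℂ} (hz : z ∉ pencilSpectrum A E)
    {Δ : Matrix (Fin m) (Fin p) ℂ} (hΔ : (1 - D * Δ).det ≠ 0) :
    (z • E - perturbed A B C D Δ).det * (1 - D * Δ).det =
      (z • E - A).det * (1 - transfer A B C D E z * Δ).det := by
  have hF : IsUnit (z • E - A).det := isUnit_iff_ne_zero.2 hz
  have hD : IsUnit (1 - D * Δ).det := isUnit_iff_ne_zero.2 hΔ
  set F := z • E - A with hFdef
  set N := 1 - D * Δ with hN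
  -- After factoring out `F`, the identity `det (1 - X Y) = det (1 - Y X)` moves `C` to the left;
  -- multiplying by `N` then clears the inverse and leaves `1 - G Δ`.
  have e1 : z • E - perturbed A B C D Δ = F * (1 - (F⁻¹ * B * Δ * N⁻¹) * C) := by
    rw [mul_sub, mul_one, perturbed, ← hN, hFdef, ← hFdef]
    simp only [Matrix.mul_assoc]
    rw [Matrix.mul_nonsing_inv_cancel_left _ _ hF]
    rw [hFdef]; abel
  have e2 : (1 - C * (F⁻¹ * B * Δ * N⁻¹)) * N = 1 - transfer A B C D E z * Δ := by
    rw [sub_mul, one_mul, transfer, ← hFdef, Matrix.add_mul]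
    simp only [Matrix.mul_assoc]
    rw [Matrix.nonsing_inv_mul _ hD, Matrix.mul_one, hN]
    abel
  rw [e1, Matrix.det_mul, Matrix.det_one_sub_mul_comm, mul_assoc, ← Matrix.det_mul, e2]

/-- Away from the eigenvalues of `(A, E)`, the spectral value set is a superlevel set of the
norm of the transfer function. -/
theorem mem_svs_iff (hε : 0 < ε) (hD : ε * ‖D‖ < 1) {z : ℂ} (hz : z ∉ pencilSpectrum A E) :
    z ∈ svs ε A B C D E ↔ ε⁻¹ ≤ ‖transfer A B C D E z‖ := by
  constructor
  · rintro ⟨Δ, hΔ, hdet⟩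
    by_contra! hlt
    have hG : ε * ‖transfer A B C D E z‖ < 1 := by
      rwa [mul_comm, ← lt_inv_mul_iff₀' hε, mul_one]
    have h := det_smul_sub_perturbed (B := B) (C := C) hz (det_one_sub_mul_ne_zero hD hΔ)
    rw [show (z • E - perturbed A B C D Δ).det = 0 from hdet, zero_mul] at h
    exact mul_ne_zero hz (det_one_sub_mul_ne_zero hG hΔ) h.symm
  · intro hge
    set G := transfer A B C D E z with hGdef
    have hpos : 0 < ‖G‖ := (inv_pos.2 hε).trans_le hge
    have hG0 : G ≠ 0 := norm_pos_iff.1 hpos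
    -- The perturbation `Δ = Gᴴ / ‖G‖²` has norm `1 / ‖G‖` and makes `1` an eigenvalue of `G Δ`.
    have hΔ : ‖((‖G‖ : ℂ) ^ 2)⁻¹ • G.conjTranspose‖ ≤ ε := by
      rw [norm_smul, Matrix.l2_opNorm_conjTranspose, norm_inv, norm_pow, Complex.norm_real,
        norm_norm]
      have : (‖G‖ ^ 2)⁻¹ * ‖G‖ = ‖G‖⁻¹ := by field_simp
      rw [this]
      exact inv_le_of_inv_le₀ hε hge
    have hne := det_one_sub_mul_ne_zero hD hΔ
    refine ⟨_, hΔ, ?_⟩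
    have h := det_smul_sub_perturbed (B := B) (C := C) hz hne
    rw [← hGdef, det_one_sub_smul_mul_conjTranspose_norm G hG0, mul_zero] at h
    exact (mul_eq_zero.1 h).resolve_right hne

end Membership

/-! ### The symplectic pencil -/

theorem fromBlocks_sub {k l o q R : Type*} [AddCommGroup R] (A A' : Matrix o l R)
    (B B' : Matrix o k R) (C C' : Matrix q l R) (D D' : Matrix q k R) :
    Matrix.fromBlocks A B C D - Matrix.fromBlocks A' B' C' D' =
      Matrix.fromBlocks (A - A') (B - B') (C - C') (D - D') := by
  simp only [sub_eq_add_neg, Matrix.fromBlocks_neg, Matrix.fromBlocks_add]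

section Pencil

variable {n m p : ℕ} (A : Matrix (Fin n) (Fin n) ℂ) (B : Matrix (Fin n) (Fin m) ℂ)
  (C : Matrix (Fin p) (Fin n) ℂ) (D : Matrix (Fin p) (Fin m) ℂ) (E : Matrix (Fin n) (Fin n) ℂ)

/-- The block matrix whose determinant vanishes exactly when `γ` is a singular value of `G`. -/
def singularBlock (γ : ℝ) (G : Matrix (Fin p) (Fin m) ℂ) :
    Matrix (Fin p ⊕ Fin m) (Fin p ⊕ Fin m) ℂ :=
  Matrix.fromBlocks ((γ : ℂ) • 1) G (-G.conjTranspose) (-((γ : ℂ) • 1))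

theorem det_singularBlock_eq_zero_iff {γ : ℝ} (hγ : 0 < γ) (G : Matrix (Fin p) (Fin m) ℂ) :
    (singularBlock γ G).det = 0 ↔
      (((γ : ℂ) ^ 2) • (1 : Matrix (Fin m) (Fin m) ℂ) - G.conjTranspose * G).det = 0 := by
  have h0 : (γ : ℂ) ≠ 0 := by exact_mod_cast hγ.ne'
  -- A block column operation that clears the upper right corner; its determinant is a power of `γ`,
  -- hence nonzero.
  have e : singularBlock γ G *
      Matrix.fromBlocks 1 (-G) 0 ((γ : ℂ) • 1) =
      Matrix.fromBlocks ((γ : ℂ) • 1) 0 (-G.conjTranspose)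
        (-(((γ : ℂ) ^ 2) • (1 : Matrix (Fin m) (Fin m) ℂ) - G.conjTranspose * G)) := by
    simp only [singularBlock, Matrix.fromBlocks_multiply]
    congr 1
    · simp
    · simp
    · simp
    · simp [-Complex.coe_smul, smul_smul, sq]
      abel
  have h := congrArg Matrix.det e
  rw [Matrix.det_mul, Matrix.det_fromBlocks_zero₂₁, Matrix.det_fromBlocks_zero₁₂,
    Matrix.det_neg] at h
  simp only [Matrix.det_one, Matrix.det_smul, one_mul, mul_one] at h
  have h1 : (γ : ℂ) ^ Fintype.card (Fin m) ≠ 0 := pow_ne_zero _ h0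
  have h2 : (γ : ℂ) ^ Fintype.card (Fin p) ≠ 0 := pow_ne_zero _ h0
  have h3 : (-1 : ℂ) ^ Fintype.card (Fin m) ≠ 0 := pow_ne_zero _ (by norm_num)
  constructor
  · intro hz
    rw [hz, zero_mul] at h
    exact (mul_eq_zero.1 ((mul_eq_zero.1 h.symm).resolve_left h2)).resolve_left h3
  · intro hz
    rw [hz] at h
    rw [mul_zero, mul_zero] at h
    exact (mul_eq_zero.1 h).resolve_right h1

/-- Neumann series: `matR γ D` is `-γ²` times `1 - γ⁻² Dᴴ D`, and `‖γ⁻² Dᴴ D‖ < 1`. -/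
theorem isUnit_det_matR {γ : ℝ} (hγ : ‖D‖ < γ) : IsUnit (matR γ D).det := by
  have h0 : 0 < γ := (norm_nonneg _).trans_lt hγ
  have hc : ((γ : ℂ) ^ 2) ≠ 0 := pow_ne_zero _ (by exact_mod_cast h0.ne')
  have hn : ‖((γ : ℂ) ^ 2)⁻¹ • (D.conjTranspose * D)‖ < 1 := by
    rw [norm_smul, Matrix.l2_opNorm_conjTranspose_mul_self, norm_inv, norm_pow, Complex.norm_real,
      Real.norm_of_nonneg h0.le, inv_mul_lt_iff₀ (by positivity), mul_one, ← sq]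
    gcongr
  have e : matR γ D = (-((γ : ℂ) ^ 2)) • (1 - ((γ : ℂ) ^ 2)⁻¹ • (D.conjTranspose * D)) := by
    rw [matR, smul_sub, smul_smul, neg_mul, mul_inv_cancel₀ hc, neg_smul, neg_smul, one_smul]
    abel
  rw [e, Matrix.det_smul]
  exact (IsUnit.pow _ (isUnit_iff_ne_zero.2 (neg_ne_zero.2 hc))).mul
    ((Matrix.isUnit_iff_isUnit_det _).1 (Units.oneSub _ hn).isUnit)

theorem isUnit_det_matS {γ : ℝ} (hγ : ‖D‖ < γ) : IsUnit (matS γ D).det := by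
  have h := isUnit_det_matR D.conjTranspose (γ := γ) (by rwa [Matrix.l2_opNorm_conjTranspose])
  rwa [matR, Matrix.conjTranspose_conjTranspose] at h

variable {D} in
theorem matS_inv_mul {γ : ℝ} (hγ : ‖D‖ < γ) : (matS γ D)⁻¹ * D = D * (matR γ D)⁻¹ := by
  have hR := isUnit_det_matR D hγ
  have hS := isUnit_det_matS D hγ
  have h : matS γ D * D = D * matR γ D := by
    simp [matS, matR, Matrix.sub_mul, Matrix.mul_sub, Matrix.mul_assoc]
  calc (matS γ D)⁻¹ * D = (matS γ D)⁻¹ * (D * matR γ D * (matR γ D)⁻¹) := by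
        rw [Matrix.mul_nonsing_inv_cancel_right _ _ hR]
    _ = D * (matR γ D)⁻¹ := by
        rw [← h, Matrix.mul_assoc, Matrix.nonsing_inv_mul_cancel_left _ _ hS]

/-- The square of `singularBlock` is block diagonal. -/
theorem singularBlock_mul_self (γ : ℝ) :
    singularBlock γ D * singularBlock γ D = Matrix.fromBlocks (-matS γ D) 0 0 (-matR γ D) := by
  simp only [singularBlock, Matrix.fromBlocks_multiply]
  congr 1
  · simp [-Complex.coe_smul, matS, smul_smul, sq]; abel
  · simp
  · simp
  · simp [-Complex.coe_smul, matR, smul_smul, sq]; abel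

/-- The middle factor of the symplectic pencil. -/
noncomputable def middleBlock (γ : ℝ) (D : Matrix (Fin p) (Fin m) ℂ) :
    Matrix (Fin p ⊕ Fin m) (Fin p ⊕ Fin m) ℂ :=
  Matrix.fromBlocks (matS γ D)⁻¹ 0 0 (matR γ D)⁻¹ * singularBlock γ D

-- `middleBlock` is minus the inverse of `singularBlock γ D`. The determinant computation uses only
-- this; the explicit entries serve to match the given pencil.
variable {D} in
theorem middleBlock_mul_singularBlock {γ : ℝ} (hγ : ‖D‖ < γ) :
    middleBlock γ D * singularBlock γ D = -1 := by
  rw [middleBlock, Matrix.mul_assoc, singularBlock_mul_self, Matrix.fromBlocks_multiply]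
  simp [Matrix.nonsing_inv_mul _ (isUnit_det_matR D hγ),
    Matrix.nonsing_inv_mul _ (isUnit_det_matS D hγ), ← Matrix.fromBlocks_one,
    Matrix.fromBlocks_neg]

variable {D} in
theorem middleBlock_eq {γ : ℝ} (hγ : ‖D‖ < γ) :
    middleBlock γ D = Matrix.fromBlocks ((γ : ℂ) • (matS γ D)⁻¹) (D * (matR γ D)⁻¹)
      (-((matR γ D)⁻¹ * D.conjTranspose)) (-((γ : ℂ) • (matR γ D)⁻¹)) := by
  rw [middleBlock, singularBlock, Matrix.fromBlocks_multiply]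
  simp [matS_inv_mul hγ]

/-- On the unit circle `z * star (r * z) = r`, which turns `r Eᴴ - z Aᴴ` into `z (r z E - A)ᴴ`. The
rest of the pencil factors through the input and output spaces. -/
theorem pencil_eq_mul {γ r : ℝ} {z : ℂ} (hz : ‖z‖ = 1) (hγ : ‖D‖ < γ) :
    pencilS γ r A B C D E - z • pencilT γ r A B C D E =
      Matrix.fromBlocks 1 0 0 (z • 1) *
        (Matrix.fromBlocks (-((r * z) • E - A)) 0 0 ((r * z) • E - A).conjTranspose +
          Matrix.fromBlocks 0 B C.conjTranspose 0 * middleBlock γ D *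
            Matrix.fromBlocks C 0 0 B.conjTranspose) := by
  have hzz : z * star z = 1 := by
    rw [Complex.star_def, Complex.mul_conj, Complex.normSq_eq_norm_sq, hz]; simp
  have hzr : z * (star (r * z)) = r := by
    rw [star_mul, ← mul_assoc, hzz, one_mul]; simp
  rw [middleBlock_eq hγ, pencilS, pencilT]
  simp only [Matrix.fromBlocks_multiply, Matrix.fromBlocks_smul, Matrix.fromBlocks_add,
    fromBlocks_sub]
  congr 1
  · simp [-Complex.coe_smul, Matrix.mul_assoc, smul_smul, mul_comm z]; abel
  · simp [Matrix.mul_assoc]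
  · simp [Matrix.mul_assoc, smul_comm z]
  · simp only [Matrix.conjTranspose_sub, Matrix.conjTranspose_smul, Matrix.zero_mul,
      Matrix.smul_mul, Matrix.one_mul, smul_sub, smul_add, smul_smul, hzr, Matrix.mul_zero,
      zero_add, add_zero, Matrix.mul_assoc]
    abel

/-- With `F = r z E - A`, the pencil is, up to an invertible factor, `P + U M V` with `P = diag(-F,
Fᴴ)` and `M` the middle block. Since `V P⁻¹ U` is the difference of the singular blocks of `D` and
`G`, and `M` is minus the inverse of the former, `1 + M V P⁻¹ U` collapses to `-M` times the
singular block of `G`. -/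
theorem det_pencil_eq_zero_iff {γ r : ℝ} {z : ℂ} (hz : ‖z‖ = 1) (hγ : ‖D‖ < γ)
    (hs : (r * z : ℂ) ∉ pencilSpectrum A E) :
    (pencilS γ r A B C D E - z • pencilT γ r A B C D E).det = 0 ↔
      (((γ : ℂ) ^ 2) • (1 : Matrix (Fin m) (Fin m) ℂ) -
        (transfer A B C D E (r * z)).conjTranspose * transfer A B C D E (r * z)).det = 0 := by
  rw [← det_singularBlock_eq_zero_iff ((norm_nonneg _).trans_lt hγ), pencil_eq_mul A B C D E hz hγ]
  have hF : IsUnit ((r * z : ℂ) • E - A).det := isUnit_iff_ne_zero.2 hs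
  have hG : transfer A B C D E (r * z) = C * ((r * z : ℂ) • E - A)⁻¹ * B + D := rfl
  generalize transfer A B C D E (r * z) = G at hG ⊢
  generalize (r * z : ℂ) • E - A = F at hF hG ⊢
  have hz0 : z ≠ 0 := by
    rintro rfl; simp at hz
  set P : Matrix (Fin n ⊕ Fin n) (Fin n ⊕ Fin n) ℂ :=
    Matrix.fromBlocks (-F) 0 0 F.conjTranspose with hP
  set U : Matrix (Fin n ⊕ Fin n) (Fin p ⊕ Fin m) ℂ :=
    Matrix.fromBlocks 0 B C.conjTranspose 0 with hU
  set V : Matrix (Fin p ⊕ Fin m) (Fin n ⊕ Fin n) ℂ :=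
    Matrix.fromBlocks C 0 0 B.conjTranspose with hV
  set Q : Matrix (Fin n ⊕ Fin n) (Fin n ⊕ Fin n) ℂ :=
    Matrix.fromBlocks (-F⁻¹) 0 0 (F⁻¹).conjTranspose with hQ
  have hPQ : P * Q = 1 := by
    rw [hP, hQ, Matrix.fromBlocks_multiply]
    simp [Matrix.mul_nonsing_inv _ hF, ← Matrix.conjTranspose_mul, Matrix.nonsing_inv_mul _ hF]
  have hVQU : V * Q * U = singularBlock γ D - singularBlock γ G := by
    rw [hV, hQ, hU, Matrix.fromBlocks_multiply, Matrix.fromBlocks_multiply, singularBlock,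
      singularBlock, fromBlocks_sub, hG]
    simp [Matrix.mul_assoc]
  have hPU : P + U * middleBlock γ D * V = P * (1 + Q * U * middleBlock γ D * V) := by
    rw [mul_add, mul_one, ← Matrix.mul_assoc, ← Matrix.mul_assoc, ← Matrix.mul_assoc, hPQ,
      Matrix.one_mul]
  have hK : 1 + middleBlock γ D * (V * Q * U) = -(middleBlock γ D * singularBlock γ G) := by
    rw [hVQU, mul_sub, middleBlock_mul_singularBlock hγ]; abel
  have hKV : (1 + Q * U * middleBlock γ D * V).det =
      (-(middleBlock γ D * singularBlock γ G)).det := by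
    rw [← hK, Matrix.mul_assoc, Matrix.det_one_add_mul_comm]
    simp only [Matrix.mul_assoc]
  have hdP : P.det ≠ 0 := by
    intro h
    have := congrArg Matrix.det hPQ
    rw [Matrix.det_mul, h] at this
    simp at this
  have hdK : (middleBlock γ D).det ≠ 0 := by
    intro h
    have := congrArg Matrix.det (middleBlock_mul_singularBlock hγ)
    rw [Matrix.det_mul, h, zero_mul, Matrix.det_neg, Matrix.det_one, mul_one] at this
    exact pow_ne_zero _ (by norm_num) this.symm
  rw [hPU, Matrix.det_mul, Matrix.det_mul, hKV, Matrix.det_neg, Matrix.det_mul,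
    Matrix.det_fromBlocks_zero₂₁, Matrix.det_smul]
  simp [hz0, hdP, hdK]

/-- A matrix pencil whose determinant does not vanish identically has finitely many
eigenvalues. -/
theorem finite_setOf_det_smul_add_eq_zero {ι : Type} [Fintype ι] [DecidableEq ι]
    (M N : Matrix ι ι ℂ) (h : M.det ≠ 0 ∨ ∃ z : ℂ, (z • M + N).det ≠ 0) :
    {z : ℂ | (z • M + N).det = 0}.Finite := by
  set q : Polynomial ℂ := ((Polynomial.X : Polynomial ℂ) • M.map Polynomial.C +
    N.map Polynomial.C).det with hq
  have hev : ∀ z : ℂ, q.eval z = (z • M + N).det := by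
    intro z
    rw [hq, ← Polynomial.coe_evalRingHom, RingHom.map_det]
    congr 1
    ext i j
    simp
    ring
  have hq0 : q ≠ 0 := by
    rcases h with h | ⟨z, hz⟩
    -- The coefficient of degree `card ι` is `M.det`.
    · intro h0
      apply h
      rw [← Polynomial.coeff_det_X_add_C_card M N, ← hq, h0, Polynomial.coeff_zero]
    · intro h0
      apply hz
      rw [← hev, h0, Polynomial.eval_zero]
  refine (q.roots.toFinset.finite_toSet).subset fun z hz => ?_
  simp only [Finset.mem_coe, Multiset.mem_toFinset]
  rw [Polynomial.mem_roots hq0, Polynomial.IsRoot, hev]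
  exact hz

end Pencil

open Set Filter Topology

/-! ### Topology of spectral value sets -/

section Topology

variable {n m p : ℕ} {A : Matrix (Fin n) (Fin n) ℂ} {B : Matrix (Fin n) (Fin m) ℂ}
  {C : Matrix (Fin p) (Fin n) ℂ} {D : Matrix (Fin p) (Fin m) ℂ} {E : Matrix (Fin n) (Fin n) ℂ}
  {ε : ℝ}

instance instProperSpaceMatrix {m p : ℕ} : ProperSpace (Matrix (Fin p) (Fin m) ℂ) :=
  FiniteDimensional.proper ℂ _

theorem isClosed_pencilSpectrum : IsClosed (pencilSpectrum A E) :=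
  isClosed_eq (by fun_prop) continuous_const

theorem continuousOn_nonsing_inv {k : ℕ} :
    ContinuousOn (fun M : Matrix (Fin k) (Fin k) ℂ => M⁻¹) {M | M.det ≠ 0} := by
  intro M hM
  have hu : IsUnit M := (Matrix.isUnit_iff_isUnit_det _).2 (isUnit_iff_ne_zero.2 hM)
  obtain ⟨u, rfl⟩ := hu
  have h := NormedRing.inverse_continuousAt u
  rw [show (fun M : Matrix (Fin k) (Fin k) ℂ => M⁻¹) = Ring.inverse from
    funext fun M => Matrix.nonsing_inv_eq_ringInverse M]
  exact h.continuousWithinAt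

theorem continuousOn_transfer : ContinuousOn (transfer A B C D E) (pencilSpectrum A E)ᶜ := by
  have h : ContinuousOn (fun z : ℂ => (z • E - A)⁻¹) (pencilSpectrum A E)ᶜ :=
    continuousOn_nonsing_inv.comp (by fun_prop) fun z hz => hz
  unfold transfer
  fun_prop

theorem continuousAt_transfer {z : ℂ} (hz : z ∉ pencilSpectrum A E) :
    ContinuousAt (transfer A B C D E) z :=
  continuousOn_transfer.continuousAt (isClosed_pencilSpectrum.isOpen_compl.mem_nhds hz)

theorem continuousOn_perturbed (hD : ε * ‖D‖ < 1) :
    ContinuousOn (perturbed A B C D) (Metric.closedBall 0 ε) := by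
  have h : ContinuousOn (fun Δ : Matrix (Fin m) (Fin p) ℂ => (1 - D * Δ)⁻¹)
      (Metric.closedBall 0 ε) :=
    continuousOn_nonsing_inv.comp (by fun_prop) fun Δ hΔ =>
      det_one_sub_mul_ne_zero hD (by simpa using hΔ)
  unfold perturbed
  fun_prop

/-- The matrices `M(Δ)` form a compact set `K`. Closedness follows by projecting a closed subset of
`K × ℂ` along `K`; boundedness because the eigenvalues of `(M, E)` are those of `E⁻¹ M`. -/
theorem isCompact_svs (hE : IsUnit E) (hD : ε * ‖D‖ < 1) : IsCompact (svs ε A B C D E) := by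
  have hK : IsCompact (perturbed A B C D '' Metric.closedBall 0 ε) :=
    (isCompact_closedBall _ _).image_of_continuousOn (continuousOn_perturbed hD)
  have hS : svs ε A B C D E = {z | ∃ M ∈ perturbed A B C D '' Metric.closedBall 0 ε,
      (z • E - M).det = 0} := by
    ext z
    simp [svs, pencilSpectrum]
  generalize perturbed A B C D '' Metric.closedBall 0 ε = K at hK hS
  rw [hS, Metric.isCompact_iff_isClosed_bounded]
  constructor
  · have := isCompact_iff_compactSpace.1 hK
    have hc : IsClosed {q : K × ℂ | (q.2 • E - (q.1 : Matrix (Fin n) (Fin n) ℂ)).det = 0} :=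
      isClosed_eq (by fun_prop) continuous_const
    convert isClosedMap_snd_of_compactSpace _ hc using 1
    ext z
    simp
  · obtain ⟨b, hb⟩ := hK.isBounded.exists_norm_le
    refine isBounded_iff_forall_norm_le.2 ⟨‖E⁻¹‖ * b, ?_⟩
    rintro z ⟨M, hM, hz⟩
    have hEd := (Matrix.isUnit_iff_isUnit_det _).1 hE
    obtain ⟨v, hv, hzv⟩ := Matrix.exists_mulVec_eq_zero_iff.2 hz
    have h1 : (E⁻¹ * M).mulVec v = z • v := by
      rw [Matrix.sub_mulVec, sub_eq_zero, Matrix.smul_mulVec] at hzv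
      rw [← Matrix.mulVec_mulVec, ← hzv, Matrix.mulVec_smul, Matrix.mulVec_mulVec,
        Matrix.nonsing_inv_mul _ hEd, Matrix.one_mulVec]
    have h2 := Matrix.l2_opNorm_mulVec (E⁻¹ * M) (WithLp.toLp 2 v)
    rw [show (WithLp.toLp 2 v).ofLp = v from rfl, h1] at h2
    have h3 : WithLp.toLp 2 (z • v) = z • (WithLp.toLp 2 v : EuclideanSpace ℂ (Fin n)) := rfl
    have h4 : 0 < ‖(WithLp.toLp 2 v : EuclideanSpace ℂ (Fin n))‖ := by
      rw [norm_pos_iff]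
      intro h
      exact hv (congrArg WithLp.ofLp h)
    have h5 : ‖z‖ ≤ ‖E⁻¹ * M‖ := by
      refine le_of_mul_le_mul_right ?_ h4
      rw [← norm_smul]
      exact h2
    exact h5.trans ((Matrix.l2_opNorm_mul _ _).trans (by gcongr; exact hb M hM))

/-- If `‖G z‖ > ε⁻¹`, continuity keeps the inequality near `z`, making `z` an interior point. -/
theorem norm_transfer_eq_of_mem_frontier (hE : IsUnit E) (hε : 0 < ε) (hD : ε * ‖D‖ < 1) {z : ℂ}
    (hz : z ∉ pencilSpectrum A E) (hf : z ∈ frontier (svs ε A B C D E)) :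
    ‖transfer A B C D E z‖ = ε⁻¹ := by
  have hcl := (isCompact_svs (A := A) (B := B) (C := C) hE hD).isClosed
  refine le_antisymm ?_ ((mem_svs_iff hε hD hz).1 (hcl.frontier_subset hf))
  by_contra! hlt
  refine hf.2 (mem_interior_iff_mem_nhds.2 ?_)
  filter_upwards [(continuousAt_transfer hz).norm.eventually_const_lt hlt,
    isClosed_pencilSpectrum.isOpen_compl.mem_nhds hz] with w hw hw'
  exact (mem_svs_iff hε hD hw').2 hw.le

end Topology

/-! ### Circles and rays in a compact set -/

section Plane

variable {K : Set ℂ} {η : ℝ}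

theorem exists_pos_forall_norm_le_add_mem (hη : 0 < η)
    (h : Metric.sphere (0 : ℂ) η ⊆ interior K) :
    ∃ d > 0, ∀ z : ℂ, η ≤ ‖z‖ → ‖z‖ ≤ η + d → z ∈ K := by
  obtain ⟨d, hd, hsub⟩ := (isCompact_sphere (0 : ℂ) η).exists_cthickening_subset_open
    isOpen_interior h
  refine ⟨d, hd, fun z h1 h2 => interior_subset (hsub ?_)⟩
  have hz : 0 < ‖z‖ := hη.trans_le h1
  have hzc : (‖z‖ : ℂ) ≠ 0 := by exact_mod_cast hz.ne'
  -- The comparison point is the radial projection of `z` to the circle, at distance `‖z‖ - η`.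
  refine Metric.mem_cthickening_of_dist_le z ((η / ‖z‖ : ℝ) * z) d _ ?_ ?_
  · rw [mem_sphere_zero_iff_norm, norm_mul, Complex.norm_real, Real.norm_of_nonneg (by positivity)]
    field_simp
  · have : z - (η / ‖z‖ : ℝ) * z = ((‖z‖ - η) / ‖z‖ : ℝ) * z := by
      push_cast
      field_simp
    rw [dist_eq_norm, this, norm_mul, Complex.norm_real,
      Real.norm_of_nonneg (div_nonneg (sub_nonneg.2 h1) hz.le), div_mul_cancel₀ _ hz.ne']
    linarith

/-- The circles swept out by a growth fill a closed annulus, a form free of the parameter `t`. -/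
theorem mem_growths_iff {d : ℝ} :
    d ∈ growths K η ↔ 0 < d ∧ ∀ z : ℂ, η ≤ ‖z‖ → ‖z‖ ≤ η + d → z ∈ K := by
  refine and_congr_right fun hd => ⟨fun h z h1 h2 => ?_, fun h t ht z hz => ?_⟩
  · refine h ((‖z‖ - η) / d) ⟨div_nonneg (by linarith) hd.le, ?_⟩ ?_
    · rw [div_le_one hd]; linarith
    · rw [mem_sphere_zero_iff_norm, div_mul_cancel₀ _ hd.ne']; ring
  · rw [mem_sphere_zero_iff_norm] at hz
    refine h z ?_ ?_
    · rw [hz]; nlinarith [ht.1]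
    · rw [hz]; nlinarith [ht.2]

/-- If the circle of radius `η` is in the interior of a compact set, there is a largest growth. -/
theorem exists_isGreatest_growths (hK : IsCompact K) (hη : 0 < η)
    (h : Metric.sphere (0 : ℂ) η ⊆ interior K) : ∃ δ, IsGreatest (growths K η) δ := by
  obtain ⟨d, hd, hdK⟩ := exists_pos_forall_norm_le_add_mem hη h
  have hne : (growths K η).Nonempty := ⟨d, mem_growths_iff.2 ⟨hd, hdK⟩⟩
  have hbdd : BddAbove (growths K η) := by
    obtain ⟨b, hb⟩ := hK.isBounded.exists_norm_le
    refine ⟨b, fun e he => ?_⟩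
    have he' := mem_growths_iff.1 he
    have hn : ‖((η + e : ℝ) : ℂ)‖ = η + e := by
      rw [Complex.norm_real, Real.norm_of_nonneg (by linarith [he'.1])]
    have := hb _ (he'.2 ((η + e : ℝ) : ℂ) (by rw [hn]; linarith [he'.1]) hn.le)
    linarith
  refine ⟨sSup (growths K η), ⟨?_, ?_⟩, fun e he => le_csSup hbdd he⟩
  · exact hd.trans_le (le_csSup hbdd (mem_growths_iff.2 ⟨hd, hdK⟩))
  · intro t ht z hz
    rw [mem_sphere_zero_iff_norm] at hz
    have hS : 0 < sSup (growths K η) :=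
      hd.trans_le (le_csSup hbdd (mem_growths_iff.2 ⟨hd, hdK⟩))
    have hpos : 0 < η + t * sSup (growths K η) := by nlinarith [ht.1]
    -- For fixed `t` and fixed direction, this closed condition holds for every growth, hence also
    -- for their supremum.
    have hcl : IsClosed {e : ℝ | ((η + t * e : ℝ) : ℂ) * (z / ‖z‖) ∈ K} :=
      hK.isClosed.preimage (by fun_prop)
    have hmem := closure_minimal (s := growths K η) (fun e he => ?_) hcl
      (csSup_mem_closure hne hbdd)
    · have hzc : (‖z‖ : ℂ) ≠ 0 := by rw [hz]; exact_mod_cast hpos.ne'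
      rw [mem_ofPred_eq, ← hz, mul_div_cancel₀ _ hzc] at hmem
      exact hmem
    · refine he.2 t ht ?_
      rw [mem_sphere_zero_iff_norm, norm_mul, norm_div, Complex.norm_real, Complex.norm_real,
        norm_norm, hz, div_self hpos.ne', mul_one,
        Real.norm_of_nonneg (by nlinarith [ht.1, he.1])]

/-- The circle reached by the largest growth meets the frontier. -/
theorem exists_mem_sphere_notMem_interior (hη : 0 < η) {δ : ℝ}
    (hδ : IsGreatest (growths K η) δ) :
    ∃ z ∈ Metric.sphere (0 : ℂ) (η + δ), z ∉ interior K := by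
  by_contra! hcon
  obtain ⟨h0, hδK⟩ := mem_growths_iff.1 hδ.1
  obtain ⟨d, hd, hdK⟩ := exists_pos_forall_norm_le_add_mem (add_pos hη h0) hcon
  have : δ + d ∈ growths K η := by
    refine mem_growths_iff.2 ⟨by linarith, fun z h1 h2 => ?_⟩
    rcases le_total ‖z‖ (η + δ) with h | h
    · exact hδK z h1 h
    · exact hdK z h (by linarith)
  linarith [hδ.2 this]

theorem norm_ofReal_mul_exp {s : ℝ} (hs : 0 ≤ s) (θ : ℝ) :
    ‖(s : ℂ) * Complex.exp (θ * Complex.I)‖ = s := by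
  rw [norm_mul, Complex.norm_exp_ofReal_mul_I, mul_one, Complex.norm_real, Real.norm_of_nonneg hs]

/-- The ray starts in the interior of `K` and ends outside `K`; without a boundary point in between,
the open sets `interior K` and `Kᶜ` would disconnect a segment. -/
theorem boundaryRadii_nonempty (hK : IsCompact K) (hη : 0 < η)
    (h : Metric.sphere (0 : ℂ) η ⊆ interior K) (θ : ℝ) : (boundaryRadii K η θ).Nonempty := by
  obtain ⟨b, hb⟩ := hK.isBounded.exists_norm_le
  set c := max b η + 1 with hc
  have hcη : η < c := by have := le_max_right b η; linarith
  have hcb : b < c := by have := le_max_left b η; linarith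
  have hηi : (η : ℂ) * Complex.exp (θ * Complex.I) ∈ interior K :=
    h (mem_sphere_zero_iff_norm.2 (norm_ofReal_mul_exp hη.le θ))
  have himg : IsPreconnected ((fun s : ℝ => (s : ℂ) * Complex.exp (θ * Complex.I)) '' Icc η c) :=
    isPreconnected_Icc.image _ (by fun_prop)
  have hcK : (c : ℂ) * Complex.exp (θ * Complex.I) ∉ K := fun hmem => by
    have := hb _ hmem
    rw [norm_ofReal_mul_exp (by linarith)] at this
    linarith
  by_contra hemp
  have hcover : (fun s : ℝ => (s : ℂ) * Complex.exp (θ * Complex.I)) '' Icc η c ⊆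
      interior K ∪ Kᶜ := by
    rintro _ ⟨s, hs, rfl⟩
    by_contra hnot
    rw [mem_union, not_or, mem_compl_iff, not_not] at hnot
    refine hemp ⟨s, lt_of_le_of_ne hs.1 ?_, subset_closure hnot.2, hnot.1⟩
    rintro rfl
    exact hnot.1 hηi
  obtain ⟨w, -, hw1, hw2⟩ := himg _ _ isOpen_interior hK.isClosed.isOpen_compl hcover
    ⟨_, ⟨η, ⟨le_rfl, hcη.le⟩, rfl⟩, hηi⟩ ⟨_, ⟨c, ⟨hcη.le, le_rfl⟩, rfl⟩, hcK⟩
  exact hw2 (interior_subset hw1)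

theorem isLeast_rHat {θ : ℝ} (hfin : (boundaryRadii K η θ).Finite)
    (hne : (boundaryRadii K η θ).Nonempty) : IsLeast (boundaryRadii K η θ) (rHat K η θ) :=
  ⟨hne.csInf_mem hfin, fun _ hs => csInf_le hfin.bddBelow hs⟩

/-- The open annulus between the radii `η` and `η + δ` lies in `K`, so it contains no boundary
points. -/
theorem add_le_of_mem_boundaryRadii {δ θ s : ℝ} (hη : 0 < η) (hδ : δ ∈ growths K η)
    (hs : s ∈ boundaryRadii K η θ) : η + δ ≤ s := by
  by_contra! hlt
  obtain ⟨-, hδK⟩ := mem_growths_iff.1 hδ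
  refine hs.2.2 (mem_interior_iff_mem_nhds.2 ?_)
  have hn := norm_ofReal_mul_exp (hη.trans hs.1).le θ
  filter_upwards [continuous_norm.continuousAt.eventually_lt continuousAt_const (hn.trans_lt hlt),
    (continuousAt_const (y := η)).eventually_lt continuous_norm.continuousAt
      (hs.1.trans_eq hn.symm)]
    with w h1 h2
  exact hδK w h2.le h1.le

end Plane

/-! ### Simple largest singular values on a circle -/

section Simple

variable {m p : ℕ}

/-- The matrices having two orthogonal right singular vectors, one for the largest singular value
and one for the singular value `γ`. -/
def orthogonalSingularPairs (m p : ℕ) (γ : ℝ) : Set (Matrix (Fin p) (Fin m) ℂ) :=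
  {G | ∃ u ∈ Metric.sphere (0 : Fin m → ℂ) 1, ∃ v ∈ Metric.sphere (0 : Fin m → ℂ) 1,
    star u ⬝ᵥ v = 0 ∧ (G.conjTranspose * G).mulVec u = ((‖G‖ : ℂ) ^ 2) • u ∧
    (G.conjTranspose * G).mulVec v = ((γ : ℂ) ^ 2) • v}

/-- The pairs `(u, v)` range over a product of compact spheres, so projecting them away preserves
closedness. The sup norm of `Fin m → ℂ` is harmless, as the spheres serve only for compactness and
to exclude zero vectors. -/
theorem isClosed_orthogonalSingularPairs (γ : ℝ) :
    IsClosed (orthogonalSingularPairs m p γ) := by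
  have hc : IsClosed {q : (Metric.sphere (0 : Fin m → ℂ) 1 × Metric.sphere (0 : Fin m → ℂ) 1) ×
      Matrix (Fin p) (Fin m) ℂ | star (q.1.1 : Fin m → ℂ) ⬝ᵥ (q.1.2 : Fin m → ℂ) = 0 ∧
        (q.2.conjTranspose * q.2).mulVec q.1.1 = ((‖q.2‖ : ℂ) ^ 2) • (q.1.1 : Fin m → ℂ) ∧
        (q.2.conjTranspose * q.2).mulVec q.1.2 = ((γ : ℂ) ^ 2) • (q.1.2 : Fin m → ℂ)} := by
    refine IsClosed.and (isClosed_eq ?_ continuous_const)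
      (IsClosed.and (isClosed_eq ?_ ?_) (isClosed_eq ?_ ?_)) <;> fun_prop
  convert isClosedMap_snd_of_compactSpace _ hc using 1
  ext G
  simp only [orthogonalSingularPairs, mem_ofPred_eq, mem_image, Prod.exists, Subtype.exists]
  aesop

-- When `γ = ‖G‖`, both vectors would lie in the same one-dimensional eigenspace, which is
-- incompatible with their being nonzero and orthogonal.
open scoped ComplexOrder in
theorem notMem_orthogonalSingularPairs {G : Matrix (Fin p) (Fin m) ℂ}
    (hG : LargestSingularValueSimple G) : G ∉ orthogonalSingularPairs m p ‖G‖ := by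
  rintro ⟨u, hu, v, hv, huv, hGu, hGv⟩
  have hu0 : u ≠ 0 := by rintro rfl; simp at hu
  have hv0 : v ≠ 0 := by rintro rfl; simp at hv
  set W := Module.End.eigenspace (Matrix.toLin' (G.conjTranspose * G)) ((‖G‖ ^ 2 : ℝ) : ℂ)
  have hmem : ∀ w : Fin m → ℂ, (G.conjTranspose * G).mulVec w = ((‖G‖ : ℂ) ^ 2) • w → w ∈ W := by
    intro w hw
    rw [Module.End.mem_eigenspace_iff, Matrix.toLin'_apply, hw]
    push_cast
    rfl
  obtain ⟨c, hc⟩ := (finrank_eq_one_iff_of_nonzero' (⟨u, hmem u hGu⟩ : W)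
    (by simpa using hu0)).1 hG ⟨v, hmem v hGv⟩
  have hc' : c • u = v := congrArg Subtype.val hc
  rw [← hc', dotProduct_smul, smul_eq_mul, mul_eq_zero, dotProduct_star_self_eq_zero] at huv
  rcases huv with h | h
  · exact hv0 (by rw [← hc', h, zero_smul])
  · exact hu0 h

theorem exists_mem_sphere_smul {v : Fin m → ℂ} (hv : v ≠ 0) :
    ∃ c : ℂ, c • v ∈ Metric.sphere (0 : Fin m → ℂ) 1 := by
  refine ⟨(‖v‖ : ℂ)⁻¹, ?_⟩
  rw [mem_sphere_zero_iff_norm, norm_smul, norm_inv, Complex.norm_real, norm_norm,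
    inv_mul_cancel₀ (norm_ne_zero_iff.2 hv)]

/-- Eigenvectors of the Hermitian matrix `Gᴴ G` for the distinct eigenvalues `‖G‖ ^ 2` and `γ ^ 2`
are orthogonal. -/
theorem mem_orthogonalSingularPairs {G : Matrix (Fin p) (Fin m) ℂ} {γ : ℝ} (hγ : 0 < γ)
    (hG : γ < ‖G‖)
    (hdet : (((γ : ℂ) ^ 2) • (1 : Matrix (Fin m) (Fin m) ℂ) - G.conjTranspose * G).det = 0) :
    G ∈ orthogonalSingularPairs m p γ := by
  have key : ∀ a : ℂ, (a • (1 : Matrix (Fin m) (Fin m) ℂ) - G.conjTranspose * G).det = 0 →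
      ∃ u ∈ Metric.sphere (0 : Fin m → ℂ) 1, (G.conjTranspose * G).mulVec u = a • u := by
    intro a ha
    obtain ⟨u, hu, h⟩ := Matrix.exists_mulVec_eq_zero_iff.2 ha
    obtain ⟨c, hc⟩ := exists_mem_sphere_smul hu
    refine ⟨_, hc, ?_⟩
    rw [Matrix.sub_mulVec, sub_eq_zero, Matrix.smul_mulVec, Matrix.one_mulVec] at h
    rw [Matrix.mulVec_smul, ← h, smul_comm]
  have hG0 : G ≠ 0 := norm_pos_iff.1 (hγ.trans hG)
  obtain ⟨u, hu, hGu⟩ := key _ (det_norm_sq_smul_sub_conjTranspose_mul_self G hG0)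
  obtain ⟨v, hv, hGv⟩ := key _ hdet
  refine ⟨u, hu, v, hv, ?_, hGu, hGv⟩
  have h1 : star u ⬝ᵥ (G.conjTranspose * G).mulVec v =
      star ((G.conjTranspose * G).mulVec u) ⬝ᵥ v := by
    rw [Matrix.star_mulVec, Matrix.dotProduct_mulVec, Matrix.conjTranspose_mul,
      Matrix.conjTranspose_conjTranspose]
  rw [hGu, hGv, star_smul, dotProduct_smul, smul_dotProduct, ← sub_eq_zero, ← sub_smul,
    smul_eq_zero] at h1
  refine h1.resolve_left fun h => ?_
  have h2 : ((γ ^ 2 - ‖G‖ ^ 2 : ℝ) : ℂ) = 0 := by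
    push_cast
    simpa using h
  have h3 : γ ^ 2 - ‖G‖ ^ 2 = 0 := by exact_mod_cast h2
  nlinarith

/-- If `γ` is a singular value of `G z` on a connected set on which the largest singular value is
simple and at least `γ`, and it is the largest one somewhere, then it is so everywhere. -/
theorem norm_eq_of_isPreconnected {X : Type*} [TopologicalSpace X] [PreconnectedSpace X]
    {G : X → Matrix (Fin p) (Fin m) ℂ} (hG : Continuous G) {γ : ℝ} (hγ : 0 < γ)
    (hsimple : ∀ x, LargestSingularValueSimple (G x)) (hle : ∀ x, γ ≤ ‖G x‖)
    (hdet : ∀ x, (((γ : ℂ) ^ 2) • (1 : Matrix (Fin m) (Fin m) ℂ) -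
      (G x).conjTranspose * G x).det = 0) {x₀ : X} (hx₀ : ‖G x₀‖ = γ) (x : X) : ‖G x‖ = γ := by
  have hclopen : IsClopen {x | ‖G x‖ = γ} := by
    refine ⟨isClosed_eq hG.norm continuous_const, ?_⟩
    -- The locus `‖G x‖ = γ`, closed by continuity, is thereby also the complement of a closed set.
    have : {x | ‖G x‖ = γ} = (G ⁻¹' orthogonalSingularPairs m p γ)ᶜ := by
      ext y
      constructor
      · rintro rfl
        exact notMem_orthogonalSingularPairs (hsimple y)
      · intro hy
        by_contra hne
        exact hy (mem_orthogonalSingularPairs hγ (lt_of_le_of_ne (hle y) (Ne.symm hne)) (hdet y))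
    rw [this]
    exact ((isClosed_orthogonalSingularPairs γ).preimage hG).isOpen_compl
  have hmem : x ∈ {x | ‖G x‖ = γ} := by
    rw [hclopen.eq_univ ⟨x₀, hx₀⟩]
    exact mem_univ x
  exact hmem

end Simple

/-! ### Maximum principle outside a circle -/

section MaxPrinciple

variable {n m p : ℕ} {A : Matrix (Fin n) (Fin n) ℂ} {B : Matrix (Fin n) (Fin m) ℂ}
  {C : Matrix (Fin p) (Fin n) ℂ} {D : Matrix (Fin p) (Fin m) ℂ} {E : Matrix (Fin n) (Fin n) ℂ}

/-- The transfer function in the coordinate `w = z⁻¹`. -/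
noncomputable def transferAtInfinity (A : Matrix (Fin n) (Fin n) ℂ) (B : Matrix (Fin n) (Fin m) ℂ)
    (C : Matrix (Fin p) (Fin n) ℂ) (D : Matrix (Fin p) (Fin m) ℂ)
    (E : Matrix (Fin n) (Fin n) ℂ) (w : ℂ) : Matrix (Fin p) (Fin m) ℂ :=
  w • (C * (E - w • A)⁻¹ * B) + D

theorem inv_smul_sub {w : ℂ} (hw : w ≠ 0) : w⁻¹ • E - A = w⁻¹ • (E - w • A) := by
  rw [smul_sub, smul_smul, inv_mul_cancel₀ hw, one_smul]

theorem transferAtInfinity_eq {w : ℂ} (hw : w ≠ 0) (hu : IsUnit (E - w • A)) :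
    transferAtInfinity A B C D E w = transfer A B C D E w⁻¹ := by
  rw [transfer, transferAtInfinity, inv_smul_sub hw]
  have h : (w⁻¹ • (E - w • A))⁻¹ = w • (E - w • A)⁻¹ := by
    have := Matrix.inv_smul' _ (Units.mk0 w⁻¹ (inv_ne_zero hw))
      ((Matrix.isUnit_iff_isUnit_det _).1 hu)
    simpa [Units.smul_def] using this
  rw [h, Matrix.mul_smul, Matrix.smul_mul]

theorem differentiableAt_transferAtInfinity {w : ℂ} (hw : IsUnit (E - w • A)) :
    DifferentiableAt ℂ (transferAtInfinity A B C D E) w := by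
  let L : Matrix (Fin n) (Fin n) ℂ →ₗ[ℂ] Matrix (Fin p) (Fin m) ℂ :=
    { toFun := fun X => C * X * B
      map_add' := fun X Y => by rw [Matrix.mul_add, Matrix.add_mul]
      map_smul' := fun c X => by simp }
  have h1 : DifferentiableAt ℂ (fun w : ℂ => E - w • A) w := by fun_prop
  have h2 := h1.inverse hw
  have h3 : DifferentiableAt ℂ (fun w : ℂ => w • L.toContinuousLinearMap
      (Ring.inverse (E - w • A)) + D) w :=
    (differentiableAt_id.smul (L.toContinuousLinearMap.differentiableAt.comp w h2)).add_const D
  convert h3 using 2 with v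
  rw [transferAtInfinity, Matrix.nonsing_inv_eq_ringInverse]
  rfl

/-- If `‖G‖ = γ > ‖D‖` on a circle enclosing the eigenvalues of `(A, E)`, then `‖G‖ < γ` outside
this circle. -/
theorem norm_transfer_lt_of_forall_sphere (hE : IsUnit E) {r γ : ℝ} (hr : 0 < r) (hγ : ‖D‖ < γ)
    (hencl : ∀ z ∈ pencilSpectrum A E, ‖z‖ < r)
    (hsph : ∀ z ∈ Metric.sphere (0 : ℂ) r, ‖transfer A B C D E z‖ = γ) {z : ℂ} (hz : r < ‖z‖) :
    ‖transfer A B C D E z‖ < γ := by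
  -- The exterior of the circle, with infinity added, becomes this disc. Invertibility at `w = 0` is
  -- that of `E`; elsewhere `w⁻¹` is no eigenvalue of `(A, E)`.
  have hunit : ∀ w ∈ Metric.closedBall (0 : ℂ) r⁻¹, IsUnit (E - w • A) := by
    intro w hw
    rcases eq_or_ne w 0 with rfl | hw0
    · simpa using hE
    rw [mem_closedBall_zero_iff] at hw
    have hle : r ≤ ‖w⁻¹‖ := by
      rw [norm_inv]; exact le_inv_of_le_inv₀ (norm_pos_iff.2 hw0) hw
    have hd : (w⁻¹ • E - A).det ≠ 0 := fun h => (hencl w⁻¹ h).not_ge hle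
    rw [inv_smul_sub hw0, Matrix.det_smul] at hd
    exact (Matrix.isUnit_iff_isUnit_det _).2 (isUnit_iff_ne_zero.2 (right_ne_zero_of_mul hd))
  set f := transferAtInfinity A B C D E with hf
  have hrp : 0 < r⁻¹ := inv_pos.2 hr
  have hdiff : DiffContOnCl ℂ f (Metric.ball 0 r⁻¹) := by
    refine DifferentiableOn.diffContOnCl fun w hw => ?_
    rw [closure_ball _ hrp.ne'] at hw
    exact (differentiableAt_transferAtInfinity (hunit w hw)).differentiableWithinAt
  have hfr : ∀ w ∈ frontier (Metric.ball (0 : ℂ) r⁻¹), ‖f w‖ ≤ γ := by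
    intro w hw
    rw [frontier_ball _ hrp.ne', mem_sphere_zero_iff_norm] at hw
    have hw0 : w ≠ 0 := by rintro rfl; simp at hw; linarith
    rw [hf, transferAtInfinity_eq hw0
      (hunit w (by rw [mem_closedBall_zero_iff, hw]))]
    exact (hsph _ (by rw [mem_sphere_zero_iff_norm, norm_inv, hw, inv_inv])).le
  have hle : ∀ w ∈ Metric.ball (0 : ℂ) r⁻¹, ‖f w‖ ≤ γ := fun w hw =>
    Complex.norm_le_of_forall_mem_frontier_norm_le Metric.isBounded_ball hdiff hfr
      (subset_closure hw)
  have hz0 : z ≠ 0 := by rintro rfl; simp at hz; linarith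
  have hzb : z⁻¹ ∈ Metric.ball (0 : ℂ) r⁻¹ := by
    rw [mem_ball_zero_iff, norm_inv]
    exact inv_strictAnti₀ hr hz
  have hfz : f z⁻¹ = transfer A B C D E z := by
    rw [hf, transferAtInfinity_eq (inv_ne_zero hz0)
      (hunit _ (Metric.ball_subset_closedBall hzb)), inv_inv]
  rw [← hfz]
  -- An interior maximum would make `‖f‖` constantly `γ` on the disc, contradicting `f 0 = D` and
  -- `‖D‖ < γ`.
  refine lt_of_le_of_ne (hle _ hzb) fun heq => ?_
  have hmax : IsMaxOn (norm ∘ f) (Metric.ball (0 : ℂ) r⁻¹) z⁻¹ := fun w hw => by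
    simpa [heq] using hle w hw
  have h0 := Complex.norm_eqOn_of_isPreconnected_of_isMaxOn
    (convex_ball (0 : ℂ) r⁻¹).isPreconnected Metric.isOpen_ball hdiff.differentiableOn hzb hmax
    (Metric.mem_ball_self hrp)
  simp only [Function.comp_apply, Function.const_apply, heq] at h0
  rw [hf, transferAtInfinity, zero_smul, zero_add] at h0
  exact hγ.ne h0

end MaxPrinciple

/-! ### The dichotomy -/

section Dichotomy

variable {n m p : ℕ} {A : Matrix (Fin n) (Fin n) ℂ} {B : Matrix (Fin n) (Fin m) ℂ}
  {C : Matrix (Fin p) (Fin n) ℂ} {D : Matrix (Fin p) (Fin m) ℂ} {E : Matrix (Fin n) (Fin n) ℂ}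
  {ε η : ℝ}

theorem norm_lt_inv (hε : 0 < ε) (hD : ε * ‖D‖ < 1) : ‖D‖ < ε⁻¹ := by
  rwa [← one_div, lt_div_iff₀' hε]

theorem notMem_pencilSpectrum (hencl : ∀ z ∈ pencilSpectrum A E, ‖z‖ < η) {z : ℂ}
    (hz : η ≤ ‖z‖) : z ∉ pencilSpectrum A E :=
  fun h => (hencl z h).not_ge hz

/-- At a boundary point of the spectral value set the determinant of the symplectic pencil
vanishes. -/
theorem det_pencil_eq_zero_of_mem_frontier (hE : IsUnit E) (hε : 0 < ε) (hD : ε * ‖D‖ < 1)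
    {r : ℝ} {z : ℂ} (hz : ‖z‖ = 1) (hs : (r * z : ℂ) ∉ pencilSpectrum A E)
    (hf : (r * z : ℂ) ∈ frontier (svs ε A B C D E)) :
    (pencilS ε⁻¹ r A B C D E - z • pencilT ε⁻¹ r A B C D E).det = 0 := by
  have h := norm_transfer_eq_of_mem_frontier hE hε hD hs hf
  rw [det_pencil_eq_zero_iff A B C D E hz (norm_lt_inv hε hD) hs, ← h]
  refine det_norm_sq_smul_sub_conjTranspose_mul_self _ (norm_pos_iff.1 ?_)
  rw [h]
  exact inv_pos.2 hε

/-- With the direction `z` fixed, the pencil is affine in `r`, and the coefficient of `r` is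
`diag(-z E, Eᴴ)`, which is invertible. Its determinant is thus a nonzero polynomial in `r`, even
where the pencil is singular in `z`. -/
theorem finite_boundaryRadii (hE : IsUnit E) (hε : 0 < ε) (hD : ε * ‖D‖ < 1) (hη : 0 < η)
    (hencl : ∀ z ∈ pencilSpectrum A E, ‖z‖ < η) (θ : ℝ) :
    (boundaryRadii (svs ε A B C D E) η θ).Finite := by
  set z := Complex.exp (θ * Complex.I) with hzdef
  have hz : ‖z‖ = 1 := Complex.norm_exp_ofReal_mul_I θ
  have hz0 : z ≠ 0 := Complex.exp_ne_zero _
  set M : Matrix (Fin n ⊕ Fin n) (Fin n ⊕ Fin n) ℂ :=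
    Matrix.fromBlocks (-(z • E)) 0 0 E.conjTranspose with hM
  have hEd : E.det ≠ 0 := isUnit_iff_ne_zero.1 ((Matrix.isUnit_iff_isUnit_det _).1 hE)
  have hMd : M.det ≠ 0 := by
    rw [hM, Matrix.det_fromBlocks_zero₂₁, Matrix.det_neg, Matrix.det_smul,
      Matrix.det_conjTranspose]
    simp [hEd, hz0]
  have hlin : ∀ r : ℝ, pencilS ε⁻¹ r A B C D E - z • pencilT ε⁻¹ r A B C D E =
      (r : ℂ) • M + (pencilS ε⁻¹ 0 A B C D E - z • pencilT ε⁻¹ 0 A B C D E) := by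
    intro r
    simp only [hM, pencilS, pencilT, Matrix.fromBlocks_smul, fromBlocks_sub, Matrix.fromBlocks_add]
    congr 1
    · simp only [smul_neg, Complex.ofReal_zero, zero_smul, smul_zero, smul_comm z]; abel
    · simp
    · simp
    · simp only [Complex.ofReal_zero, zero_smul]; abel
  have hfin := (finite_setOf_det_smul_add_eq_zero M
    (pencilS ε⁻¹ 0 A B C D E - z • pencilT ε⁻¹ 0 A B C D E) (Or.inl hMd)).preimage
    (f := ((↑) : ℝ → ℂ)) Complex.ofReal_injective.injOn
  refine hfin.subset fun s hs => ?_
  have hn := norm_ofReal_mul_exp (hη.trans hs.1).le θ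
  have := det_pencil_eq_zero_of_mem_frontier hE hε hD hz
    (notMem_pencilSpectrum hencl (hs.1.le.trans_eq hn.symm)) hs.2
  rw [hlin] at this
  exact this

/-- For a regular pencil, almost no ray has a boundary point on the circle of radius `r`. -/
theorem ae_notMem_boundaryRadii (hE : IsUnit E) (hε : 0 < ε) (hD : ε * ‖D‖ < 1)
    (hη : 0 < η) (hencl : ∀ z ∈ pencilSpectrum A E, ‖z‖ < η) {r : ℝ}
    (hreg : IsRegularPencil (pencilS ε⁻¹ r A B C D E) (pencilT ε⁻¹ r A B C D E)) :
    ∀ᵐ θ ∂uniformAngle, r ∉ boundaryRadii (svs ε A B C D E) η θ := by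
  set Z := {z : ℂ | (z • (-pencilT ε⁻¹ r A B C D E) + pencilS ε⁻¹ r A B C D E).det = 0} with hZ
  have hrw : ∀ z : ℂ, z • (-pencilT ε⁻¹ r A B C D E) + pencilS ε⁻¹ r A B C D E =
      pencilS ε⁻¹ r A B C D E - z • pencilT ε⁻¹ r A B C D E := fun z => by
    rw [smul_neg]; abel
  have hZfin : Z.Finite := by
    refine finite_setOf_det_smul_add_eq_zero _ _ (Or.inr ?_)
    obtain ⟨z, hz⟩ := hreg
    exact ⟨z, by rwa [hrw]⟩
  have hinj : InjOn (fun θ : ℝ => Complex.exp (θ * Complex.I)) (Ico 0 (2 * Real.pi)) := by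
    have h := injOn_circleMap_of_abs_sub_le' (c := 0) (R := 1) one_ne_zero
      (a := 0) (b := 2 * Real.pi) (by simp)
    rw [funext (circleMap_zero 1)] at h
    simpa using h
  -- Each of the finitely many zeros on the unit circle comes from a single angle in `[0, 2π)`.
  have hbad : (Ico (0 : ℝ) (2 * Real.pi) ∩
      (fun θ : ℝ => Complex.exp (θ * Complex.I)) ⁻¹' Z).Finite :=
    Set.Finite.of_finite_image (hZfin.subset (by rintro _ ⟨θ, hθ, rfl⟩; exact hθ.2))
      (hinj.mono inter_subset_left)
  have h1 : ∀ᵐ θ ∂uniformAngle, θ ∉ Ico (0 : ℝ) (2 * Real.pi) ∩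
      (fun θ : ℝ => Complex.exp (θ * Complex.I)) ⁻¹' Z :=
    ProbabilityTheory.cond_absolutelyContinuous.ae_le
      (MeasureTheory.measure_eq_zero_iff_ae_notMem.1 (hbad.measure_zero _))
  have h2 : ∀ᵐ θ ∂uniformAngle, θ ∈ Ico (0 : ℝ) (2 * Real.pi) :=
    ProbabilityTheory.ae_cond_mem measurableSet_Ico
  filter_upwards [h1, h2] with θ hθ hθ' hr
  refine hθ ⟨hθ', ?_⟩
  have hn := norm_ofReal_mul_exp (hη.trans hr.1).le θ
  have := det_pencil_eq_zero_of_mem_frontier hE hε hD (Complex.norm_exp_ofReal_mul_I θ)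
    (notMem_pencilSpectrum hencl (hr.1.le.trans_eq hn.symm)) hr.2
  rw [mem_preimage, hZ, mem_ofPred_eq, hrw]
  exact this

/-- If the symplectic pencil is singular for the radius `r` and the largest singular value of the
transfer function is simple on the circle of radius `r`, which is a subset of the spectral value
set but not of its interior, then the norm of the transfer function is constant on it. -/
theorem norm_transfer_eq_on_sphere (hE : IsUnit E) (hε : 0 < ε) (hD : ε * ‖D‖ < 1) {r : ℝ}
    (hr : 0 < r) (hencl : ∀ z ∈ pencilSpectrum A E, ‖z‖ < r)
    (hsub : Metric.sphere (0 : ℂ) r ⊆ svs ε A B C D E)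
    (hex : ∃ z ∈ Metric.sphere (0 : ℂ) r, z ∉ interior (svs ε A B C D E))
    (hsimple : ∀ z ∈ Metric.sphere (0 : ℂ) r, LargestSingularValueSimple (transfer A B C D E z))
    (hsing : IsSingularPencil (pencilS ε⁻¹ r A B C D E) (pencilT ε⁻¹ r A B C D E)) :
    ∀ z ∈ Metric.sphere (0 : ℂ) r, ‖transfer A B C D E z‖ = ε⁻¹ := by
  have hns : ∀ z ∈ Metric.sphere (0 : ℂ) r, z ∉ pencilSpectrum A E := fun z hz =>
    notMem_pencilSpectrum hencl (mem_sphere_zero_iff_norm.1 hz).ge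
  have : PreconnectedSpace (Metric.sphere (0 : ℂ) r) :=
    isPreconnected_iff_preconnectedSpace.1
      (isPreconnected_sphere (by rw [Complex.rank_real_complex]; norm_num) 0 r)
  obtain ⟨z₀, hz₀, hz₀i⟩ := hex
  intro z hz
  refine norm_eq_of_isPreconnected
    (G := fun x : Metric.sphere (0 : ℂ) r => transfer A B C D E x)
    ((continuousOn_transfer (A := A) (E := E)).comp_continuous continuous_subtype_val
      fun x => hns x x.2) (inv_pos.2 hε)
    (fun x => hsimple x x.2) (fun x => (mem_svs_iff hε hD (hns x x.2)).1 (hsub x.2))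
    (fun x => ?_) (x₀ := ⟨z₀, hz₀⟩)
    (norm_transfer_eq_of_mem_frontier hE hε hD (hns _ hz₀)
      ⟨subset_closure (hsub hz₀), hz₀i⟩) ⟨z, hz⟩
  have hrc : (r : ℂ) ≠ 0 := by exact_mod_cast hr.ne'
  -- Singularity is used at the unit complex number `x / r`, which makes `γ` a singular value of `G
  -- x`.
  have hx : (r : ℂ) * ((x : ℂ) / r) = x := mul_div_cancel₀ _ hrc
  have hx1 : ‖(x : ℂ) / r‖ = 1 := by
    rw [norm_div, Complex.norm_real, Real.norm_of_nonneg hr.le, mem_sphere_zero_iff_norm.1 x.2,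
      div_self hr.ne']
  have h := (det_pencil_eq_zero_iff A B C D E hx1 (norm_lt_inv hε hD)
    (by rw [hx]; exact hns x x.2)).1 (hsing _)
  rwa [hx] at h

end Dichotomy

end SpectralValueSet

open SpectralValueSet in
theorem mainTheorem1 {n m p : ℕ}
    (A : Matrix (Fin n) (Fin n) ℂ) (B : Matrix (Fin n) (Fin m) ℂ)
    (C : Matrix (Fin p) (Fin n) ℂ) (D : Matrix (Fin p) (Fin m) ℂ)
    (E : Matrix (Fin n) (Fin n) ℂ) (hE : IsUnit E)
    (ε : ℝ) (hε : 0 < ε) (hD : ε * ‖D‖ < 1)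
    (η : ℝ) (hη : 0 < η)
    (hencl : ∀ z ∈ pencilSpectrum A E, ‖z‖ < η)
    (hint : Metric.sphere (0 : ℂ) η ⊆ interior (svs ε A B C D E)) :
    -- the spectral value set radius is an attained maximum
    IsGreatest ((fun z : ℂ => ‖z‖) '' svs ε A B C D E) (svsRadius ε A B C D E) ∧
    -- on every ray there are finitely many boundary radii beyond `η`, with minimum `rHat`
    (∀ θ ∈ Set.Ico (0 : ℝ) (2 * Real.pi),
      (boundaryRadii (svs ε A B C D E) η θ).Finite ∧
      IsLeast (boundaryRadii (svs ε A B C D E) η θ) (rHat (svs ε A B C D E) η θ)) ∧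
    -- the largest growth `δ` exists, and the dichotomy holds for it
    ∃ δ : ℝ, IsGreatest (growths (svs ε A B C D E) η) δ ∧
      ((∀ z ∈ Metric.sphere (0 : ℂ) (η + δ),
          LargestSingularValueSimple (transfer A B C D E z)) →
        (IsSingularPencil (pencilS ε⁻¹ (η + δ) A B C D E) (pencilT ε⁻¹ (η + δ) A B C D E) ∧
          η + δ = svsRadius ε A B C D E ∧
          ∀ θ ∈ Set.Ico (0 : ℝ) (2 * Real.pi), rHat (svs ε A B C D E) η θ = η + δ) ∨
        (IsRegularPencil (pencilS ε⁻¹ (η + δ) A B C D E) (pencilT ε⁻¹ (η + δ) A B C D E) ∧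
          ∀ᵐ θ ∂uniformAngle, η + δ < rHat (svs ε A B C D E) η θ)) := by
  have hK : IsCompact (svs ε A B C D E) := isCompact_svs hE hD
  have hleast : ∀ θ : ℝ,
      IsLeast (boundaryRadii (svs ε A B C D E) η θ) (rHat (svs ε A B C D E) η θ) := fun θ =>
    isLeast_rHat (finite_boundaryRadii hE hε hD hη hencl θ) (boundaryRadii_nonempty hK hη hint θ)
  have hne : (svs ε A B C D E).Nonempty :=
    ((NormedSpace.sphere_nonempty.2 hη.le).mono hint).mono interior_subset
  have hgr : IsGreatest ((fun z : ℂ => ‖z‖) '' svs ε A B C D E) (svsRadius ε A B C D E) :=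
    (hK.image continuous_norm).isGreatest_sSup (hne.image _)
  refine ⟨hgr, fun θ _ => ⟨finite_boundaryRadii hE hε hD hη hencl θ, hleast θ⟩, ?_⟩
  obtain ⟨δ, hδ⟩ := exists_isGreatest_growths hK hη hint
  refine ⟨δ, hδ, fun hsimple => ?_⟩
  obtain ⟨hδ0, hδK⟩ := mem_growths_iff.1 hδ.1
  have hge : ∀ θ, η + δ ≤ rHat (svs ε A B C D E) η θ := fun θ =>
    add_le_of_mem_boundaryRadii hη hδ.1 (hleast θ).1
  by_cases hreg : IsRegularPencil (pencilS ε⁻¹ (η + δ) A B C D E) (pencilT ε⁻¹ (η + δ) A B C D E)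
  · refine Or.inr ⟨hreg, ?_⟩
    filter_upwards [ae_notMem_boundaryRadii hE hε hD hη hencl hreg] with θ hθ
    exact lt_of_le_of_ne (hge θ) fun h => hθ (h ▸ (hleast θ).1)
  · have hsing : IsSingularPencil (pencilS ε⁻¹ (η + δ) A B C D E)
        (pencilT ε⁻¹ (η + δ) A B C D E) := fun z => by
      by_contra h
      exact hreg ⟨z, h⟩
    have hr : 0 < η + δ := add_pos hη hδ0
    have hencl' : ∀ z ∈ pencilSpectrum A E, ‖z‖ < η + δ := fun z hz =>
      (hencl z hz).trans (by linarith)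
    have hsub : Metric.sphere (0 : ℂ) (η + δ) ⊆ svs ε A B C D E := fun z hz => by
      rw [mem_sphere_zero_iff_norm] at hz
      exact hδK z (by linarith) hz.le
    have hconst := norm_transfer_eq_on_sphere hE hε hD hr hencl' hsub
      (exists_mem_sphere_notMem_interior hη hδ) hsimple hsing
    have hout : ∀ z ∈ svs ε A B C D E, ‖z‖ ≤ η + δ := fun z hz => by
      by_contra! hlt
      have h1 := norm_transfer_lt_of_forall_sphere hE hr (norm_lt_inv hε hD) hencl' hconst hlt
      exact h1.not_ge ((mem_svs_iff hε hD (notMem_pencilSpectrum hencl' hlt.le)).1 hz)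
    have hrad : η + δ = svsRadius ε A B C D E := by
      refine IsGreatest.unique ⟨?_, ?_⟩ hgr
      · obtain ⟨z, hz⟩ := NormedSpace.sphere_nonempty (x := (0 : ℂ)).2 hr.le
        exact ⟨z, hsub hz, mem_sphere_zero_iff_norm.1 hz⟩
      · rintro _ ⟨z, hz, rfl⟩
        exact hout z hz
    refine Or.inl ⟨hsing, hrad, fun θ _ => le_antisymm ?_ (hge θ)⟩
    -- The boundary point at radius `rHat` belongs to the closed spectral value set, so its modulus
    -- is at most `η + δ`.
    have hpos : 0 ≤ rHat (svs ε A B C D E) η θ := hr.le.trans (hge θ)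
    have h := hout _ (hK.isClosed.frontier_subset (hleast θ).1.2)
    rwa [norm_ofReal_mul_exp hpos] at h
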